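/- Let $k$ be an algebraically closed field and let $A$ be a finite dimensional (associative, unital) $k$-algebra. Let $D^{\mathrm{perf}}(A)$ be the triangulated category of perfect complexes of $A$-modules, i.e. the full subcategory of the derived category of $A$-modules on the objects isomorphic to a bounded complex of finitely generated projective $A$-modules. Let $\mathrm{Thick}(D^{\mathrm{perf}}(A))$ be the lattice of thick subcategories of $D^{\mathrm{perf}}(A)$ (full triangulated subcategories closed under isomorphisms and direct summands), ordered by inclusion: the meet is the intersection, and the join of $\mathcal U$ and $\mathcal V$ is the smallest thick subcategory containing $\mathcal U\cup\mathcal V$. If this lattice is distributive, i.e. $\mathcal U\wedge(\mathcal V\vee\mathcal W)=(\mathcal U\wedge\mathcal V)\vee(\mathcal U\wedge\mathcal W)$ for all thick subcategories $\mathcal U,\mathcal V,\mathcal W$, then $\mathrm{Hom}_A(P,Q)=0$ for any two non-isomorphic indecomposable projective $A$-modules $P$ and $Q$. -/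

import Mathlib

open CategoryTheory CategoryTheory.Limits CategoryTheory.Pretriangulated
open scoped ZeroObject

universe w v u p q

/-- A lattice is distributive if meets distribute over joins. -/
def LatticeIsDistributive (L : Type*) [Lattice L] : Prop :=
  ∀ x y z : L, x ⊓ (y ⊔ z) = (x ⊓ y) ⊔ (x ⊓ z)

section Thick

variable (T : Type u) [Category.{v} T] [HasZeroObject T] [HasShift T ℤ]
  [Preadditive T] [∀ n : ℤ, (shiftFunctor T n).Additive] [Pretriangulated T]

/-- A thick subcategory of a triangulated category `T`: a (strictly) full triangulated
subcategory that is closed under direct summands. -/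
@[ext]
structure ThickSubcategory where
  /-- the predicate singling out the objects of the subcategory -/
  prop : ObjectProperty T
  isTriangulated : prop.IsTriangulated
  isClosedUnderIsomorphisms : prop.IsClosedUnderIsomorphisms
  isStableUnderRetracts : prop.IsStableUnderRetracts

namespace ThickSubcategory

variable {T}

/-- Thick subcategories are ordered by inclusion. -/
instance : PartialOrder (ThickSubcategory T) :=
  PartialOrder.lift ThickSubcategory.prop (fun _ _ h => ThickSubcategory.ext h)

/-- The intersection of a family of thick subcategories. -/
instance : InfSet (ThickSubcategory T) where
  sInf S :=
    { prop := fun X => ∀ U ∈ S, U.prop X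
      isTriangulated :=
        { exists_zero := by
            refine ⟨0, isZero_zero T, fun U _ => ?_⟩
            have := U.isTriangulated
            have := U.isClosedUnderIsomorphisms
            exact U.prop.prop_of_isZero (isZero_zero T)
          isStableUnderShiftBy := fun n => ⟨fun X hX U hU => by
            have := U.isTriangulated
            exact U.prop.le_shift n _ (hX U hU)⟩
          ext₂' := fun D hD h₁ h₃ => ObjectProperty.le_isoClosure _ _ (fun U hU => by
            have := U.isTriangulated
            have := U.isClosedUnderIsomorphisms
            exact U.prop.ext_of_isTriangulatedClosed₂ D hD (h₁ U hU) (h₃ U hU)) }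
      isClosedUnderIsomorphisms := ⟨fun e hX U hU => by
        have := U.isClosedUnderIsomorphisms
        exact U.prop.prop_of_iso e (hX U hU)⟩
      isStableUnderRetracts := ⟨fun r hX U hU => by
        have := U.isStableUnderRetracts
        exact U.prop.prop_of_retract r (hX U hU)⟩ }

/-- The complete lattice of thick subcategories: meets are intersections, and the join of a
family is the smallest thick subcategory containing all its members. -/
instance : CompleteLattice (ThickSubcategory T) :=
  completeLatticeOfInf _ (fun _ =>
    ⟨fun _ hU _ hX => hX _ hU, fun _ hV _ hX _ hU => hV hU _ hX⟩)

end ThickSubcategory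

end Thick

section Perfect

variable (A : Type v) [Ring A]

/-- A bounded cochain complex of finitely generated projective `A`-modules. -/
structure IsStrictlyPerfect (K : CochainComplex (ModuleCat.{v} A) ℤ) : Prop where
  bounded_below : ∃ a : ℤ, K.IsStrictlyGE a
  bounded_above : ∃ b : ℤ, K.IsStrictlyLE b
  finite : ∀ n : ℤ, Module.Finite A (K.X n)
  projective : ∀ n : ℤ, Module.Projective A (K.X n)

variable {A}

lemma IsStrictlyPerfect.isKProjective {K : CochainComplex (ModuleCat.{v} A) ℤ}
    (hK : IsStrictlyPerfect A K) : K.IsKProjective := by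
  obtain ⟨b, hb⟩ := hK.bounded_above
  have : ∀ n, CategoryTheory.Projective (K.X n) := fun n =>
    (IsProjective.iff_projective _).1 (hK.projective n)
  exact CochainComplex.isKProjective_of_projective K b

lemma IsStrictlyPerfect.shift {K : CochainComplex (ModuleCat.{v} A) ℤ}
    (hK : IsStrictlyPerfect A K) (n : ℤ) : IsStrictlyPerfect A (K⟦n⟧) where
  bounded_below := by
    obtain ⟨a, ha⟩ := hK.bounded_below
    exact ⟨a - n, K.isStrictlyGE_shift a n (a - n) (by ring)⟩
  bounded_above := by
    obtain ⟨b, hb⟩ := hK.bounded_above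
    exact ⟨b - n, K.isStrictlyLE_shift b n (b - n) (by ring)⟩
  finite i := hK.finite (i + n)
  projective i := hK.projective (i + n)

lemma IsStrictlyPerfect.mappingCone {K L : CochainComplex (ModuleCat.{v} A) ℤ}
    (hK : IsStrictlyPerfect A K) (hL : IsStrictlyPerfect A L) (f : K ⟶ L) :
    IsStrictlyPerfect A (CochainComplex.mappingCone f) := by
  have e : ∀ n : ℤ, Nonempty
      (((CochainComplex.mappingCone f).X n) ≃ₗ[A] (K.X (n + 1) × L.X n)) := fun n =>
    ⟨(HomologicalComplex.homotopyCofiber.XIsoBiprod f n (n + 1) rfl ≪≫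
      ModuleCat.biprodIsoProd _ _).toLinearEquiv⟩
  refine ⟨?_, ?_, fun n => ?_, fun n => ?_⟩
  · obtain ⟨a, ha⟩ := hK.bounded_below
    obtain ⟨b, hb⟩ := hL.bounded_below
    refine ⟨min (a - 1) b, (CochainComplex.isStrictlyGE_iff _ _).2 fun i hi => ?_⟩
    exact (CochainComplex.mappingCone.isZero_X_iff f i).2
      ⟨K.isZero_of_isStrictlyGE a _ (by omega), L.isZero_of_isStrictlyGE b _ (by omega)⟩
  · obtain ⟨a, ha⟩ := hK.bounded_above
    obtain ⟨b, hb⟩ := hL.bounded_above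
    refine ⟨max a b, (CochainComplex.isStrictlyLE_iff _ _).2 fun i hi => ?_⟩
    exact (CochainComplex.mappingCone.isZero_X_iff f i).2
      ⟨K.isZero_of_isStrictlyLE a _ (by omega), L.isZero_of_isStrictlyLE b _ (by omega)⟩
  · obtain ⟨e⟩ := e n
    have := hK.finite (n + 1)
    have := hL.finite n
    exact Module.Finite.equiv e.symm
  · obtain ⟨e⟩ := e n
    have := hK.projective (n + 1)
    have := hL.projective n
    exact Module.Projective.of_equiv e.symm

variable (A) [HasDerivedCategory.{w} (ModuleCat.{v} A)]

/-- The perfect complexes: the objects of the derived category of `A`-modules that are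
isomorphic, in the derived category, to a bounded complex of finitely generated projective
modules. -/
def perfectComplexes : ObjectProperty (DerivedCategory (ModuleCat.{v} A)) :=
  fun X => ∃ K : CochainComplex (ModuleCat.{v} A) ℤ,
    IsStrictlyPerfect A K ∧ Nonempty (X ≅ DerivedCategory.Q.obj K)

instance : (perfectComplexes A).IsClosedUnderIsomorphisms where
  of_iso e := by
    rintro ⟨K, hK, ⟨i⟩⟩
    exact ⟨K, hK, ⟨e.symm ≪≫ i⟩⟩

instance : (perfectComplexes A).IsStableUnderShift ℤ where
  isStableUnderShiftBy n := ⟨by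
    rintro X ⟨K, hK, ⟨i⟩⟩
    exact ⟨K⟦n⟧, hK.shift n, ⟨(shiftFunctor _ n).mapIso i ≪≫
      ((DerivedCategory.Q.commShiftIso n).app K).symm⟩⟩⟩

instance : (perfectComplexes A).IsTriangulatedClosed₃ := by
  refine ObjectProperty.IsTriangulatedClosed₃.mk' ?_
  rintro T hT ⟨K, hK, ⟨i⟩⟩ ⟨L, hL, ⟨j⟩⟩
  have := hK.isKProjective
  obtain ⟨g, hg⟩ := (CochainComplex.IsKProjective.Qh_map_bijective K
    ((HomotopyCategory.quotient _ _).obj L)).surjective (i.inv ≫ T.mor₁ ≫ j.hom)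
  obtain ⟨f, rfl⟩ := (HomotopyCategory.quotient _ _).map_surjective g
  refine ⟨_, hK.mappingCone hL f, ⟨Triangle.π₃.mapIso (isoTriangleOfIso₁₂ T _ hT
    (DerivedCategory.mappingCone_triangle_distinguished f) i j ?_)⟩⟩
  change T.mor₁ ≫ j.hom = i.hom ≫ DerivedCategory.Q.map f
  have hf : DerivedCategory.Q.map f = i.inv ≫ T.mor₁ ≫ j.hom := hg
  rw [hf, Iso.hom_inv_id_assoc]

instance : (perfectComplexes A).IsTriangulated where
  exists_zero := by
    refine ⟨DerivedCategory.Q.obj 0, DerivedCategory.Q.map_isZero (isZero_zero _), 0,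
      ⟨⟨0, ?_⟩, ⟨0, ?_⟩, fun n => ?_, fun n => ?_⟩, ⟨Iso.refl _⟩⟩
    · exact (CochainComplex.isStrictlyGE_iff _ _).2 fun _ _ =>
        (HomologicalComplex.eval _ _ _).map_isZero (isZero_zero _)
    · exact (CochainComplex.isStrictlyLE_iff _ _).2 fun _ _ =>
        (HomologicalComplex.eval _ _ _).map_isZero (isZero_zero _)
    · have := ModuleCat.subsingleton_of_isZero
        ((HomologicalComplex.eval (ModuleCat.{v} A) (ComplexShape.up ℤ) n).map_isZero
          (isZero_zero _))
      exact inferInstanceAs (Module.Finite A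
        ((HomologicalComplex.eval (ModuleCat.{v} A) (ComplexShape.up ℤ) n).obj 0))
    · have := ModuleCat.subsingleton_of_isZero
        ((HomologicalComplex.eval (ModuleCat.{v} A) (ComplexShape.up ℤ) n).map_isZero
          (isZero_zero _))
      exact inferInstanceAs (Module.Projective A
        ((HomologicalComplex.eval (ModuleCat.{v} A) (ComplexShape.up ℤ) n).obj 0))
  toIsTriangulatedClosed₂ := .of_isTriangulatedClosed₃

/-- The triangulated category of perfect complexes of `A`-modules, as a full triangulated
subcategory of the derived category of `A`-modules. -/
abbrev DPerf := (perfectComplexes A).FullSubcategory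

end Perfect

/-- An indecomposable module: a nonzero module that is not the direct sum of two nonzero
submodules. -/
structure IsIndecomposableModule (A : Type*) [Ring A] (M : Type*) [AddCommGroup M]
    [Module A M] : Prop where
  nontrivial : Nontrivial M
  eq_bot_or_eq_bot : ∀ N N' : Submodule A M, IsCompl N N' → N = ⊥ ∨ N' = ⊥

/-!
Suppose that `f : P → Q` is a nonzero map between non-isomorphic indecomposable projective modules,
and let `C` be the cone of `f` in the category of perfect complexes.

The thick subcategories generated by `P` and `Q` meet in zero
(`isZero_of_generatedBy_of_generatedBy`): a simple module `S` cannot be a quotient of both `P` and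
`Q`, so an object `X` of the intersection has no maps to the shifts of `S`. By the long exact
sequence `X` then has no maps to the shifts of any module of finite length, in particular of `P`,
and hence none to itself. Since `P` lies in the thick subcategory generated by `C` and `Q`,
distributivity forces `P` into the thick subcategory generated by `C` alone
(`ThickSubcategory.prop_generatedBy_of_distrib`).

This is contradicted by a module `Z` such that composition with `f` is a bijection from `Hom(Q, Z)`
to `Hom(P, Z)` and these spaces are not zero: all objects of the thick subcategory generated by `C`
are then orthogonal to the shifts of `Z`, but `P` is not. Such a `Z` exists for a suitable choice of
`f` (`IsIndecomposableModule.exists_bijective_comp`). One takes `Z` of minimal length among the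
modules that admit a nonzero composition `P → Q → Z`. Over an algebraically closed field the
endomorphisms of `P` and `Q` are scalars up to nilpotents, and minimality of `Z` then makes
`Hom(P, Z)` and `Hom(Q, Z)` one-dimensional.
-/

/-! ### Indecomposable projective modules -/

section Modules

variable {A : Type*} [Ring A]

/-- **Fitting's lemma** for an indecomposable module of finite length. -/
lemma IsIndecomposableModule.bijective_or_isNilpotent {M : Type*} [AddCommGroup M] [Module A M]
    [IsNoetherian A M] [IsArtinian A M] (hM : IsIndecomposableModule A M) (e : Module.End A M) :
    Function.Bijective e ∨ IsNilpotent e := by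
  obtain ⟨n, hn, h⟩ := ((Filter.eventually_ge_atTop 1).and
    (LinearMap.eventually_isCompl_ker_pow_range_pow e)).exists
  rcases hM.eq_bot_or_eq_bot _ _ h with h0 | h0
  · left
    rw [h0] at h
    have h1 := eq_top_of_bot_isCompl h
    have hn' : n ≠ 0 := by omega
    constructor
    · rw [← LinearMap.ker_eq_bot, eq_bot_iff, ← h0]
      obtain ⟨m, rfl⟩ := Nat.exists_eq_succ_of_ne_zero hn'
      intro x hx
      simp only [LinearMap.mem_ker] at hx ⊢
      rw [Nat.succ_eq_add_one, pow_succ, Module.End.mul_apply, hx, map_zero]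
    · rw [← LinearMap.range_eq_top, eq_top_iff, ← h1]
      obtain ⟨m, rfl⟩ := Nat.exists_eq_succ_of_ne_zero hn'
      rintro _ ⟨x, rfl⟩
      rw [Nat.succ_eq_add_one, pow_succ', Module.End.mul_apply]
      exact LinearMap.mem_range_self _ _
  · right
    exact ⟨n, LinearMap.range_eq_bot.1 h0⟩

/-- A map from a projective module lifts along any map whose image contains its image. -/
lemma exists_lift_of_range_le {M N Z : Type*} [AddCommGroup M] [Module A M]
    [Module.Projective A M] [AddCommGroup N] [Module A N] [AddCommGroup Z] [Module A Z]
    (u : N →ₗ[A] Z) (a : M →ₗ[A] Z) (h : LinearMap.range a ≤ LinearMap.range u) :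
    ∃ g : M →ₗ[A] N, u ∘ₗ g = a := by
  obtain ⟨g, hg⟩ := Module.projective_lifting_property u.rangeRestrict
    (a.codRestrict _ fun x => h ⟨x, rfl⟩) u.surjective_rangeRestrict
  refine ⟨g, LinearMap.ext fun x => ?_⟩
  exact congrArg Subtype.val (LinearMap.congr_fun hg x)

/-- A finite length indecomposable projective module is determined by any of its nonzero
quotients: it is isomorphic to every other indecomposable projective module with the same
quotient. -/
lemma IsIndecomposableModule.nonempty_linearEquiv_of_surjective {M N S : Type*}
    [AddCommGroup M] [Module A M] [IsNoetherian A M] [IsArtinian A M] [Module.Projective A M]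
    [AddCommGroup N] [Module A N] [Module.Projective A N]
    [AddCommGroup S] [Module A S] [Nontrivial S]
    (hM : IsIndecomposableModule A M) (hN : IsIndecomposableModule A N)
    {a : M →ₗ[A] S} (ha : Function.Surjective a) {b : N →ₗ[A] S} (hb : Function.Surjective b) :
    Nonempty (M ≃ₗ[A] N) := by
  obtain ⟨h, hh⟩ := Module.projective_lifting_property b a hb
  obtain ⟨g, hg⟩ := Module.projective_lifting_property a b ha
  have hgh : a ∘ₗ (g ∘ₗ h) = a := by rw [← LinearMap.comp_assoc, hg, hh]
  -- `g ∘ h` lifts the identity of `S`, so it is not nilpotent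
  have hbij : Function.Bijective (g ∘ₗ h) := by
    refine (hM.bijective_or_isNilpotent (g ∘ₗ h)).resolve_right ?_
    rintro ⟨n, hn⟩
    have key : ∀ m : ℕ, a ∘ₗ ((g ∘ₗ h : Module.End A M) ^ m) = a := by
      intro m
      induction m with
      | zero => rfl
      | succ m ih =>
        rw [pow_succ', Module.End.mul_eq_comp, ← LinearMap.comp_assoc, hgh, ih]
    have h0 := key n
    rw [hn, LinearMap.comp_zero] at h0
    obtain ⟨s, hs⟩ := exists_ne (0 : S)
    obtain ⟨x, rfl⟩ := ha s
    rw [← h0] at hs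
    exact hs rfl
  have hcompl : IsCompl (LinearMap.range h) (LinearMap.ker g) := by
    refine IsCompl.of_le ?_ ?_
    · rintro _ ⟨⟨x, rfl⟩, hx⟩
      have : x = 0 := hbij.1 (by simpa using hx)
      simp [this]
    · intro y _
      obtain ⟨x, hx⟩ := hbij.2 (g y)
      refine Submodule.mem_sup.2 ⟨h x, ⟨x, rfl⟩, y - h x, ?_, by simp⟩
      simpa [sub_eq_zero] using hx.symm
  have hinj : Function.Injective h := Function.Injective.of_comp (f := g) hbij.1
  rcases hN.eq_bot_or_eq_bot _ _ hcompl with h0 | h0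
  · exfalso
    obtain ⟨x, hx⟩ := @exists_ne _ hM.nontrivial (0 : M)
    exact hx (hinj (by simp [LinearMap.range_eq_bot.1 h0]))
  · rw [h0] at hcompl
    exact ⟨LinearEquiv.ofBijective h
      ⟨hinj, LinearMap.range_eq_top.1 (eq_top_of_isCompl_bot hcompl)⟩⟩

/-- A module receiving a nonzero map from a finite length projective module also receives one from
an indecomposable one: a nonzero map restricts to a nonzero map on some indecomposable summand. -/
lemma exists_indecomposable_of_ne_zero {S : Type*} [AddCommGroup S] [Module A S]
    {M : Type v} [AddCommGroup M] [Module A M] [IsNoetherian A M] [IsArtinian A M]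
    [Module.Projective A M] (a : M →ₗ[A] S) (ha : a ≠ 0) :
    ∃ (N : Type v) (_ : AddCommGroup N) (_ : Module A N), IsNoetherian A N ∧ IsArtinian A N ∧
      Module.Projective A N ∧ IsIndecomposableModule A N ∧ ∃ b : N →ₗ[A] S, b ≠ 0 := by
  induction hl : Module.length A M using WellFoundedLT.induction generalizing M with
  | ind l ih =>
  by_cases hM : IsIndecomposableModule A M
  · exact ⟨M, _, _, ‹_›, ‹_›, ‹_›, hM, a, ha⟩
  have hnt : Nontrivial M := by
    by_contra h
    rw [not_nontrivial_iff_subsingleton] at h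
    exact ha (LinearMap.ext fun x => by simp [Subsingleton.elim x 0])
  obtain ⟨N₁, N₂, h, h₁, h₂⟩ : ∃ N₁ N₂ : Submodule A M, IsCompl N₁ N₂ ∧ N₁ ≠ ⊥ ∧ N₂ ≠ ⊥ := by
    by_contra! hcon
    exact hM ⟨hnt, fun N₁ N₂ h => or_iff_not_imp_left.2 (hcon N₁ N₂ h)⟩
  by_contra hcon
  have key : ∀ N N' : Submodule A M, IsCompl N N' → N' ≠ ⊥ → a ∘ₗ N.subtype = 0 := by
    intro N N' h h'
    by_contra hne
    have hNtop : N ≠ ⊤ := by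
      rintro rfl
      exact h' (eq_bot_of_top_isCompl h)
    have : Module.Projective A N := Module.Projective.of_split N.subtype
      (N.projectionOnto N' h) (by ext x; simp)
    exact hcon (ih _ (hl ▸ Submodule.length_lt hNtop) (a ∘ₗ N.subtype) hne rfl)
  refine ha (LinearMap.ext fun x => ?_)
  have hx : x ∈ N₁ ⊔ N₂ := by rw [h.sup_eq_top]; trivial
  obtain ⟨y, hy, z, hz, rfl⟩ := Submodule.mem_sup.1 hx
  have e₁ : a y = 0 := LinearMap.congr_fun (key N₁ N₂ h h₂) ⟨y, hy⟩
  have e₂ : a z = 0 := LinearMap.congr_fun (key N₂ N₁ h.symm h₁) ⟨z, hz⟩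
  simp [e₁, e₂]

end Modules

/-- Every nonzero projective module over a left noetherian ring has a simple quotient. -/
lemma Module.Projective.exists_surjective_isSimpleModule {A : Type v} [Ring A] [IsNoetherianRing A]
    {P : Type*} [AddCommGroup P] [Module A P] [Module.Projective A P] [Nontrivial P] :
    ∃ (S : Type v) (_ : AddCommGroup S) (_ : Module A S), IsSimpleModule A S ∧
      ∃ a : P →ₗ[A] S, Function.Surjective a := by
  obtain ⟨s, hs⟩ := Module.projective_def'.1 ‹Module.Projective A P›
  obtain ⟨x, hx⟩ := exists_ne (0 : P)
  have hsx : s x ≠ 0 := fun h => hx (by simpa [h] using (LinearMap.congr_fun hs x).symm)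
  obtain ⟨y, hy⟩ := Finsupp.ne_iff.1 hsx
  let φ : P →ₗ[A] A := Finsupp.lapply y ∘ₗ s
  have : Nontrivial (LinearMap.range φ) := by
    refine (Submodule.nontrivial_iff_ne_bot).2 fun h => hy ?_
    exact LinearMap.congr_fun (LinearMap.range_eq_bot.1 h) x
  obtain ⟨m, hm⟩ := IsCoatomic.exists_coatom (Submodule A (LinearMap.range φ))
  exact ⟨_, _, _, isSimpleModule_iff_isCoatom.2 hm, m.mkQ ∘ₗ φ.rangeRestrict,
    m.mkQ_surjective.comp φ.surjective_rangeRestrict⟩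

/-- Over a left artinian ring, every indecomposable projective module has finite length and is
isomorphic to a module in the universe of the ring. -/
lemma IsIndecomposableModule.exists_linearEquiv_finite {A : Type v} [Ring A] [IsArtinianRing A]
    {P : Type*} [AddCommGroup P] [Module A P] [Module.Projective A P]
    (hP : IsIndecomposableModule A P) :
    ∃ (N : Type v) (_ : AddCommGroup N) (_ : Module A N), IsNoetherian A N ∧ IsArtinian A N ∧
      Module.Projective A N ∧ IsIndecomposableModule A N ∧ Nonempty (N ≃ₗ[A] P) := by
  have := hP.nontrivial
  obtain ⟨S, _, _, _, a, ha⟩ :=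
    Module.Projective.exists_surjective_isSimpleModule (A := A) (P := P)
  have := IsSimpleModule.nontrivial A S
  obtain ⟨s, hs⟩ := exists_ne (0 : S)
  obtain ⟨N, _, _, _, _, _, hN, b, hb⟩ := exists_indecomposable_of_ne_zero
    (LinearMap.toSpanSingleton A S s)
    fun h => hs (by simpa using LinearMap.congr_fun h (1 : A))
  exact ⟨N, _, _, ‹_›, ‹_›, ‹_›, hN, hN.nonempty_linearEquiv_of_surjective hP
    (LinearMap.surjective_of_ne_zero hb) ha⟩

section AlgClosed

variable {k : Type u} [Field k] [IsAlgClosed k] {A : Type v} [Ring A] [Algebra k A]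

/-- Over an algebraically closed field, an endomorphism of a finite dimensional indecomposable
module is a scalar plus a nilpotent endomorphism. -/
lemma IsIndecomposableModule.exists_isNilpotent_sub_smul {M : Type*} [AddCommGroup M]
    [Module k M] [Module A M] [IsScalarTower k A M] [Module.Finite k M] [IsNoetherian A M]
    [IsArtinian A M] (hM : IsIndecomposableModule A M) (e : Module.End A M) :
    ∃ c : k, IsNilpotent (e - c • (1 : Module.End A M)) := by
  have := hM.nontrivial
  obtain ⟨c, hc⟩ := Module.End.exists_eigenvalue (e.restrictScalars k)
  refine ⟨c, (hM.bijective_or_isNilpotent _).resolve_left fun h => ?_⟩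
  obtain ⟨x, hx⟩ := hc.exists_hasEigenvector
  refine hx.2 (h.1 ?_)
  have := hx.apply_eq_smul
  simp only [LinearMap.coe_restrictScalars] at this
  simp [this]

/-- The image of a nonzero map `u` from an indecomposable projective module has a simple top, and
the maps onto that top are the multiples of the one induced by `u`. Hence every other map into the
image of `u` can be corrected by a multiple of `u` to a map with strictly smaller image. -/
lemma IsIndecomposableModule.exists_range_sub_smul_lt {M Z : Type*} [AddCommGroup M]
    [Module k M] [Module A M] [IsScalarTower k A M] [Module.Finite k M] [IsNoetherian A M]
    [IsArtinian A M] [Module.Projective A M] (hM : IsIndecomposableModule A M)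
    [AddCommGroup Z] [Module k Z] [Module A Z] [IsScalarTower k A Z]
    {u a : M →ₗ[A] Z} (hu : u ≠ 0) (h : LinearMap.range a ≤ LinearMap.range u) :
    ∃ c : k, LinearMap.range (a - c • u) < LinearMap.range u := by
  obtain ⟨e, rfl⟩ := exists_lift_of_range_le u a h
  obtain ⟨c, hc⟩ := hM.exists_isNilpotent_sub_smul (k := k) e
  set n : Module.End A M := e - c • 1 with hn
  have hun : u ∘ₗ e - c • u = u ∘ₗ n := by
    ext x
    simp only [hn, LinearMap.sub_apply, LinearMap.comp_apply, LinearMap.smul_apply, map_sub,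
      Module.End.one_apply]
    rw [LinearMap.map_smul_of_tower]
  -- if `u ∘ n` had the same image as `u`, then `u` would factor as `u ∘ (n ∘ e')`, where `n ∘ e'` is
  -- nilpotent because `n` is not surjective
  refine ⟨c, hun ▸ lt_of_le_of_ne (LinearMap.range_comp_le_range _ _) fun heq => hu ?_⟩
  obtain ⟨e', he'⟩ := exists_lift_of_range_le (u ∘ₗ n) u heq.ge
  have := hM.nontrivial
  obtain ⟨m, hm⟩ : IsNilpotent (n * e') := by
    refine (hM.bijective_or_isNilpotent _).resolve_left fun hb => ?_
    have hsurj : Function.Surjective n := Function.Surjective.of_comp (g := e') hb.2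
    obtain ⟨j, hj⟩ := hc
    have hs := hsurj.iterate j
    rw [← Module.End.coe_pow, hj] at hs
    obtain ⟨x, hx⟩ := exists_ne (0 : M)
    obtain ⟨y, hy⟩ := hs x
    exact hx hy.symm
  have key : ∀ m : ℕ, u ∘ₗ ((n * e') ^ m) = u := by
    intro m
    induction m with
    | zero => rfl
    | succ m ih =>
      rw [pow_succ', Module.End.mul_eq_comp, ← LinearMap.comp_assoc, Module.End.mul_eq_comp,
        ← LinearMap.comp_assoc, he', ← Module.End.mul_eq_comp, ih]
  rw [← key m, hm, LinearMap.comp_zero]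

/-- If there is a nonzero map between two indecomposable projective modules `P` and `Q`, then
there are a map `f : P → Q` and a module `Z` such that every map `P → Z` extends uniquely along
`f` to a map `Q → Z`, and such that some map `P → Z` is nonzero. Such a `Z` is a module of minimal
length among those admitting a nonzero composition `P → Q → Z`; both spaces of maps to `Z` are
then one-dimensional. -/
lemma IsIndecomposableModule.exists_bijective_comp {P Q : Type v}
    [AddCommGroup P] [Module k P] [Module A P] [IsScalarTower k A P] [Module.Finite k P]
    [IsNoetherian A P] [IsArtinian A P] [Module.Projective A P]
    [AddCommGroup Q] [Module k Q] [Module A Q] [IsScalarTower k A Q] [Module.Finite k Q]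
    [IsNoetherian A Q] [IsArtinian A Q] [Module.Projective A Q]
    (hP : IsIndecomposableModule A P) (hQ : IsIndecomposableModule A Q)
    (f₀ : P →ₗ[A] Q) (hf₀ : f₀ ≠ 0) :
    ∃ (Z : Type v) (_ : AddCommGroup Z) (_ : Module A Z) (f : P →ₗ[A] Q),
      Function.Bijective (fun u : Q →ₗ[A] Z => u ∘ₗ f) ∧ ∃ w : P →ₗ[A] Z, w ≠ 0 := by
  let L : Set ℕ∞ := {n | ∃ (Z : Type v) (_ : AddCommGroup Z) (_ : Module A Z),
    IsNoetherian A Z ∧ IsArtinian A Z ∧ Module.length A Z = n ∧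
      ∃ (u : Q →ₗ[A] Z) (g : P →ₗ[A] Q), u ∘ₗ g ≠ 0}
  have hL : L.Nonempty :=
    ⟨_, Q, _, _, ‹_›, ‹_›, rfl, LinearMap.id, f₀, by simpa using hf₀⟩
  obtain ⟨Z, _, _, _, _, hlen, u, f, huf⟩ := WellFounded.min_mem wellFounded_lt L hL
  have hmin : ∀ (W : Type v) [AddCommGroup W] [Module A W] [IsNoetherian A W] [IsArtinian A W],
      Module.length A W < Module.length A Z →
      ∀ (v : Q →ₗ[A] W) (g : P →ₗ[A] Q), v ∘ₗ g = 0 := by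
    intro W _ _ _ _ hW v g
    by_contra hne
    exact WellFounded.not_lt_min wellFounded_lt L
      (⟨W, _, _, ‹_›, ‹_›, rfl, v, g, hne⟩ : Module.length A W ∈ L) (hlen ▸ hW)
  -- no nonzero map from `P` factors through the image of a map `Q → Z` that is not surjective
  have hsub : ∀ (v : Q →ₗ[A] Z), LinearMap.range v ≠ ⊤ → ∀ w : P →ₗ[A] Z,
      LinearMap.range w ≤ LinearMap.range v → w = 0 := by
    intro v hv w hw
    obtain ⟨g, rfl⟩ := exists_lift_of_range_le v w hw
    have h0 := hmin _ (Submodule.length_lt hv) v.rangeRestrict g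
    ext x
    exact congrArg Subtype.val (LinearMap.congr_fun h0 x)
  have hu : LinearMap.range u = ⊤ := by
    by_contra h
    exact huf (hsub u h _ (LinearMap.range_comp_le_range _ _))
  -- the image of every map from `P` lies in every nonzero submodule
  have hquot : ∀ (T : Submodule A Z), T ≠ ⊥ → ∀ w : P →ₗ[A] Z, LinearMap.range w ≤ T := by
    intro T hT w
    obtain ⟨g, rfl⟩ := exists_lift_of_range_le u w (hu ▸ le_top)
    have h0 := hmin (Z ⧸ T) (Submodule.length_quotient_lt T hT) (T.mkQ ∘ₗ u) g
    rintro _ ⟨x, rfl⟩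
    rw [← T.ker_mkQ]
    exact LinearMap.congr_fun h0 x
  let _ : Module k Z := Module.compHom Z (algebraMap k A)
  have : IsScalarTower k A Z := ⟨fun c a z => by
    change (c • a) • z = algebraMap k A c • a • z
    rw [Algebra.smul_def, mul_smul]⟩
  have hu0 : u ≠ 0 := fun h => huf (by rw [h, LinearMap.zero_comp])
  have hrange : ∀ {M : Type v} [AddCommGroup M] [Module A M] {a : M →ₗ[A] Z}, a ≠ 0 →
      LinearMap.range a ≠ ⊥ := fun h h' => h (LinearMap.range_eq_bot.1 h')
  refine ⟨Z, _, _, f, ⟨?_, fun w => ?_⟩, _, huf⟩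
  · refine (injective_iff_map_eq_zero (AddMonoidHom.mk' (fun v : Q →ₗ[A] Z => v ∘ₗ f)
      fun v v' => LinearMap.add_comp f v' v)).2 fun v hv => ?_
    obtain ⟨c, hc⟩ := hQ.exists_range_sub_smul_lt (k := k) hu0
      (show LinearMap.range v ≤ LinearMap.range u from hu ▸ le_top)
    -- a nonzero `v - c • u` would be a nonsurjective map whose image contains that of `u ∘ f`
    have h1 : v = c • u := by
      by_contra hne
      exact huf (hsub _ (hu ▸ hc.ne) _ (hquot _ (hrange (sub_ne_zero.2 hne)) _))
    have hv' : v ∘ₗ f = 0 := hv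
    rw [h1, LinearMap.smul_comp] at hv'
    rw [h1, (smul_eq_zero.1 hv').resolve_right huf, zero_smul]
  · obtain ⟨c, hc⟩ := hP.exists_range_sub_smul_lt (k := k) huf (hquot _ (hrange huf) w)
    refine ⟨c • u, ?_⟩
    change (c • u) ∘ₗ f = w
    rw [LinearMap.smul_comp]
    -- a nonzero `w - c • (u ∘ f)` would have an image strictly inside that of `u ∘ f`
    by_contra hne
    exact hc.not_ge (hquot _ (hrange (sub_ne_zero.2 (Ne.symm hne))) _)

end AlgClosed

/-! ### Orthogonality and generation in triangulated categories -/

section Orthogonal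

variable {T : Type*} [Category* T] [HasShift T ℤ]

/-- The objects isomorphic to a shift of `X`. -/
abbrev shiftOrbit (X : T) : ObjectProperty T := (ObjectProperty.singleton X).shiftClosure ℤ

lemma shiftOrbit_self (X : T) : shiftOrbit X X :=
  ObjectProperty.le_shiftClosure _ _ (by simp)

variable [Preadditive T]

/-- `X` is left orthogonal to all shifts of `Y` if and only if all graded maps from `X` to `Y`
vanish. -/
lemma leftOrthogonal_shiftOrbit_iff {X Y : T} :
    (shiftOrbit Y).leftOrthogonal X ↔ ∀ (n : ℤ) (f : X ⟶ Y⟦n⟧), f = 0 := by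
  constructor
  · intro h n f
    exact h f (ObjectProperty.IsStableUnderShiftBy.le_shift (a := n) _ (shiftOrbit_self Y))
  · rintro h Y' f ⟨Y'', n, i, hY''⟩
    obtain rfl : Y = Y'' := by simpa using hY''
    rw [← cancel_mono i.hom, zero_comp]
    exact h n _

/-- All shifts of `X` and `Y` are orthogonal as soon as the shifts of one of the two objects are
orthogonal to the other. -/
lemma leftOrthogonal_shiftOrbit_iff_rightOrthogonal {X Y : T} :
    (shiftOrbit Y).leftOrthogonal X ↔ (shiftOrbit X).rightOrthogonal Y := by
  constructor
  · intro h X' f hX'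
    have hle : shiftOrbit X ≤ (shiftOrbit Y).leftOrthogonal := by
      rw [ObjectProperty.shiftClosure_le_iff]
      intro X'' hX''
      obtain rfl : X = X'' := by simpa using hX''
      exact h
    exact hle _ hX' f (shiftOrbit_self Y)
  · intro h Y' f hY'
    have hle : shiftOrbit Y ≤ (shiftOrbit X).rightOrthogonal := by
      rw [ObjectProperty.shiftClosure_le_iff]
      intro Y'' hY''
      obtain rfl : Y = Y'' := by simpa using hY''
      exact h
    exact hle _ hY' f (shiftOrbit_self X)

variable [HasZeroObject T] [∀ n : ℤ, (shiftFunctor T n).Additive] [Pretriangulated T]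

/-- The long exact sequence of maps from a triangle to the shifts of an object `Y`. -/
lemma leftOrthogonal_obj₃_of_bijective {D : Triangle T} (hD : D ∈ distTriang T) {Y : T}
    (h : ∀ n : ℤ, Function.Bijective fun u : D.obj₂ ⟶ Y⟦n⟧ => D.mor₁ ≫ u) :
    (shiftOrbit Y).leftOrthogonal D.obj₃ := by
  rw [leftOrthogonal_shiftOrbit_iff]
  intro n g
  have h₁ : D.mor₂ ≫ g = 0 := (h n).1 (by
    dsimp only
    rw [reassoc_of% comp_distTriang_mor_zero₁₂ _ hD, zero_comp, comp_zero])
  obtain ⟨w, rfl⟩ := Triangle.yoneda_exact₃ _ hD g h₁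
  let e := (shiftFunctorAdd' T (n - 1) 1 n (by ring)).app Y
  obtain ⟨w', hw'⟩ := (shiftFunctor T (1 : ℤ)).map_surjective (w ≫ e.hom)
  obtain ⟨u, rfl⟩ := (h (n - 1)).2 w'
  have hw : w = D.mor₁⟦(1 : ℤ)⟧' ≫ u⟦(1 : ℤ)⟧' ≫ e.inv := by
    rw [← Functor.map_comp_assoc, ← cancel_mono e.hom, ← hw', Category.assoc,
      e.inv_hom_id]
    exact (Category.comp_id _).symm
  rw [hw, reassoc_of% comp_distTriang_mor_zero₃₁ _ hD, zero_comp]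

instance (B : ObjectProperty T) : B.leftOrthogonal.IsStableUnderRetracts where
  of_retract r hY Z f hZ := by
    rw [← Category.id_comp f, ← r.retract, Category.assoc, hY (r.r ≫ f) hZ, comp_zero]

instance (B : ObjectProperty T) : B.rightOrthogonal.IsStableUnderRetracts where
  of_retract r hY Z f hZ := by
    rw [← Category.comp_id f, ← r.retract, ← Category.assoc, hY (f ≫ r.i) hZ, zero_comp]

namespace ThickSubcategory

/-- The smallest thick subcategory containing the object `X`. -/
def generatedBy (X : T) : ThickSubcategory T := sInf {U | U.prop X}

lemma generatedBy_le_iff {X : T} {U : ThickSubcategory T} : generatedBy X ≤ U ↔ U.prop X :=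
  ⟨fun h => h _ fun _ hV => hV, fun h => sInf_le h⟩

lemma prop_generatedBy (X : T) : (generatedBy X).prop X := generatedBy_le_iff.1 le_rfl

lemma prop_obj₁_of_distinguished (U : ThickSubcategory T) {D : Triangle T} (hD : D ∈ distTriang T)
    (h₂ : U.prop D.obj₂) (h₃ : U.prop D.obj₃) : U.prop D.obj₁ := by
  have := U.isTriangulated
  have := U.isClosedUnderIsomorphisms
  exact U.prop.ext_of_isTriangulatedClosed₁ D hD h₂ h₃

lemma prop_of_isZero (U : ThickSubcategory T) {X : T} (hX : IsZero X) : U.prop X := by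
  have := U.isTriangulated
  have := U.isClosedUnderIsomorphisms
  exact U.prop.prop_of_isZero hX

lemma prop_inf_iff {U V : ThickSubcategory T} {X : T} :
    (U ⊓ V).prop X ↔ U.prop X ∧ V.prop X := by
  constructor
  · exact fun h => ⟨inf_le_left (a := U) (b := V) _ h, inf_le_right (a := U) (b := V) _ h⟩
  · rintro ⟨hU, hV⟩
    exact le_inf (generatedBy_le_iff.2 hU) (generatedBy_le_iff.2 hV) _ (prop_generatedBy X)

/-- In a distributive lattice of thick subcategories, if `X` and `Y` generate thick subcategories
that meet in zero, then the cone of any map `X ⟶ Y` generates `X`. -/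
lemma prop_generatedBy_of_distrib (hT : LatticeIsDistributive (ThickSubcategory T))
    {D : Triangle T} (hD : D ∈ distTriang T)
    (h : ∀ X, (generatedBy D.obj₁).prop X → (generatedBy D.obj₂).prop X → IsZero X) :
    (generatedBy D.obj₃).prop D.obj₁ := by
  have h₁ : generatedBy D.obj₁ ≤ generatedBy D.obj₃ ⊔ generatedBy D.obj₂ :=
    generatedBy_le_iff.2 (prop_obj₁_of_distinguished _ hD
      ((le_sup_right : generatedBy D.obj₂ ≤ _) _ (prop_generatedBy _))
      ((le_sup_left : generatedBy D.obj₃ ≤ _) _ (prop_generatedBy _)))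
  have h₂ : generatedBy D.obj₁ ⊓ generatedBy D.obj₂ ≤ generatedBy D.obj₃ := fun X hX =>
    prop_of_isZero _ (h X (prop_inf_iff.1 hX).1 (prop_inf_iff.1 hX).2)
  have h₃ : generatedBy D.obj₁ ≤ generatedBy D.obj₃ := by
    rw [← inf_eq_left.2 h₁, hT]
    exact sup_le inf_le_right h₂
  exact generatedBy_le_iff.1 h₃

/-- The thick subcategory of a triangulated full subcategory `C.FullSubcategory` cut out by a
thick subcategory `B` of the ambient category. -/
def ofInverseImage (C B : ObjectProperty T) [C.IsTriangulated] [B.IsTriangulated]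
    [B.IsClosedUnderIsomorphisms] [B.IsStableUnderRetracts] :
    ThickSubcategory C.FullSubcategory where
  prop := B.inverseImage C.ι
  isTriangulated := inferInstance
  isClosedUnderIsomorphisms := inferInstance
  isStableUnderRetracts := ⟨fun r hY => B.prop_of_retract (r.map C.ι) hY⟩

end ThickSubcategory

end Orthogonal

/-! ### Projective objects in the derived category -/

namespace DerivedCategory

section

variable {C : Type*} [Category* C] [Abelian C] [HasDerivedCategory.{w} C]

/-- In nonzero degrees there are no nonzero maps from a projective object to another object: in
positive degrees because the source is projective, in negative degrees by the canonical t-structure. -/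
lemma singleFunctor_hom_shift_eq_zero {P : C} [Projective P] (M : C) {n : ℤ} (hn : n ≠ 0)
    (g : (singleFunctor C 0).obj P ⟶ ((singleFunctor C 0).obj M)⟦n⟧) : g = 0 := by
  let K := (CochainComplex.singleFunctor C 0).obj P
  let L := ((CochainComplex.singleFunctor C 0).obj M)⟦n⟧
  have : L.IsStrictlyGE (-n) := CochainComplex.isStrictlyGE_shift _ 0 n _ (by ring)
  have : L.IsStrictlyLE (-n) := CochainComplex.isStrictlyLE_shift _ 0 n _ (by ring)
  let e : Q.obj L ≅ ((singleFunctor C 0).obj M)⟦n⟧ := (Q.commShiftIso n).app _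
  rw [← cancel_mono e.inv, zero_comp]
  rcases lt_or_gt_of_ne hn with hn | hn
  · exact (subsingleton_hom_of_isStrictlyLE_of_isStrictlyGE K L 0 (-n) (by omega)).elim _ _
  · exact from_singleFunctor_obj_eq_zero_of_projective (i := 0) (g ≫ e.inv) (-n) (by omega)

lemma leftOrthogonal_singleFunctor_iff {P : C} [Projective P] {M : C} :
    (shiftOrbit ((singleFunctor C 0).obj M)).leftOrthogonal ((singleFunctor C 0).obj P) ↔
      ∀ f : P ⟶ M, f = 0 := by
  rw [leftOrthogonal_shiftOrbit_iff]
  constructor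
  · intro h f
    apply (singleFunctor C 0).map_injective
    rw [← cancel_mono ((shiftFunctorZero (DerivedCategory C) ℤ).inv.app _), Functor.map_zero,
      zero_comp]
    exact h 0 _
  · intro h n g
    by_cases hn : n = 0
    · subst hn
      rw [← cancel_mono ((shiftFunctorZero (DerivedCategory C) ℤ).hom.app _)]
      obtain ⟨f, hf⟩ := (singleFunctor C 0).map_surjective
        (g ≫ (shiftFunctorZero (DerivedCategory C) ℤ).hom.app _)
      rw [zero_comp]
      exact hf.symm.trans (by rw [h f, Functor.map_zero])
    · exact singleFunctor_hom_shift_eq_zero M hn g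

/-- If every map `P ⟶ M` extends uniquely along the map `f : P ⟶ Q` of projective objects, then the
same holds in the derived category for maps to all shifts of `M`. -/
lemma bijective_singleFunctor_map_comp {P Q M : C} [Projective P] [Projective Q] (f : P ⟶ Q)
    (hf : Function.Bijective fun u : Q ⟶ M => f ≫ u) (n : ℤ) :
    Function.Bijective
      fun u : (singleFunctor C 0).obj Q ⟶ ((singleFunctor C 0).obj M)⟦n⟧ =>
        (singleFunctor C 0).map f ≫ u := by
  by_cases hn : n = 0
  · subst hn
    let e := (shiftFunctorZero (DerivedCategory C) ℤ).app ((singleFunctor C 0).obj M)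
    have hsurj : ∀ {X : C} (g : (singleFunctor C 0).obj X ⟶ ((singleFunctor C 0).obj M)⟦(0 : ℤ)⟧),
        ∃ g' : X ⟶ M, g = (singleFunctor C 0).map g' ≫ e.inv := fun g => by
      obtain ⟨g', hg'⟩ := (singleFunctor C 0).map_surjective (g ≫ e.hom)
      exact ⟨g', by rw [hg', Category.assoc, e.hom_inv_id, Category.comp_id]⟩
    constructor
    · intro x y hxy
      obtain ⟨x', rfl⟩ := hsurj x
      obtain ⟨y', rfl⟩ := hsurj y
      dsimp only at hxy
      rw [← Category.assoc, ← Category.assoc, cancel_mono, ← Functor.map_comp,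
        ← Functor.map_comp] at hxy
      rw [hf.1 ((singleFunctor C 0).map_injective hxy)]
    · intro x
      obtain ⟨x', rfl⟩ := hsurj x
      obtain ⟨y, rfl⟩ := hf.2 x'
      exact ⟨(singleFunctor C 0).map y ≫ e.inv, by dsimp only; rw [Functor.map_comp, Category.assoc]⟩
  · exact ⟨fun x y _ => by
      rw [singleFunctor_hom_shift_eq_zero M hn x, singleFunctor_hom_shift_eq_zero M hn y],
      fun x => ⟨0, by
        rw [singleFunctor_hom_shift_eq_zero M hn x]; exact comp_zero⟩⟩

end

end DerivedCategory

section Modules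

open DerivedCategory

variable {A : Type v} [Ring A] [HasDerivedCategory.{w} (ModuleCat.{v} A)]

/-- Orthogonality to all finite length modules can be tested on simple modules. -/
lemma leftOrthogonal_singleFunctor_of_isFiniteLength {X : DerivedCategory (ModuleCat.{v} A)}
    (hX : ∀ (S : Type v) [AddCommGroup S] [Module A S] [IsSimpleModule A S],
      (shiftOrbit ((singleFunctor (ModuleCat.{v} A) 0).obj (ModuleCat.of A S))).leftOrthogonal X)
    {M : Type v} [AddCommGroup M] [Module A M] (hM : IsFiniteLength A M) :
    (shiftOrbit ((singleFunctor (ModuleCat.{v} A) 0).obj (ModuleCat.of A M))).leftOrthogonal X := by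
  induction hM with
  | of_subsingleton =>
    rw [leftOrthogonal_shiftOrbit_iff]
    intro n f
    exact (Functor.map_isZero _ (Functor.map_isZero _
      (ModuleCat.isZero_of_subsingleton _))).eq_zero_of_tgt f
  | @of_simple_quotient M _ _ N _ _ ih =>
    rw [leftOrthogonal_shiftOrbit_iff_rightOrthogonal] at ih ⊢
    have hS := hX (M ⧸ N)
    rw [leftOrthogonal_shiftOrbit_iff_rightOrthogonal] at hS
    have hse : (ModuleCat.shortComplexOfCompEqZero N.subtype N.mkQ (by ext; simp)).ShortExact :=
      ModuleCat.shortComplex_shortExact _ (LinearMap.exact_subtype_mkQ N)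
        N.subtype_injective N.mkQ_surjective
    exact ObjectProperty.ext_of_isTriangulatedClosed₂ _ _ hse.singleTriangle_distinguished ih hS

lemma perfectComplexes_singleFunctor {P : Type v} [AddCommGroup P] [Module A P]
    [Module.Finite A P] [Module.Projective A P] :
    perfectComplexes A ((singleFunctor (ModuleCat.{v} A) 0).obj (ModuleCat.of A P)) := by
  let K := (CochainComplex.singleFunctor (ModuleCat.{v} A) 0).obj (ModuleCat.of A P)
  refine ⟨K, ⟨⟨0, inferInstance⟩, ⟨0, inferInstance⟩, fun n => ?_, fun n => ?_⟩, ⟨Iso.refl _⟩⟩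
  all_goals
    by_cases hn : n = 0
    · subst hn
      let e : P ≃ₗ[A] K.X 0 := (HomologicalComplex.singleObjXSelf (ComplexShape.up ℤ) 0
        (ModuleCat.of A P)).symm.toLinearEquiv
      first
      | exact Module.Finite.equiv e
      | exact Module.Projective.of_equiv e
    · have : Subsingleton (K.X n) := ModuleCat.subsingleton_of_isZero
        (HomologicalComplex.isZero_single_obj_X (ComplexShape.up ℤ) 0 (ModuleCat.of A P) n hn)
      infer_instance

end Modules

/-! ### Perfect complexes -/

section Perfect

open DerivedCategory ThickSubcategory

variable {A : Type v} [Ring A] [HasDerivedCategory.{w} (ModuleCat.{v} A)]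

variable (A) in
/-- A finitely generated projective module, as a perfect complex concentrated in degree zero. -/
noncomputable def perfectOfModule (P : Type v) [AddCommGroup P] [Module A P]
    [Module.Finite A P] [Module.Projective A P] : DPerf A :=
  ⟨(singleFunctor (ModuleCat.{v} A) 0).obj (ModuleCat.of A P), perfectComplexes_singleFunctor⟩

/-- The perfect complexes orthogonal to all shifts of a given object `M` form a thick subcategory,
even though `M` itself need not be perfect. -/
lemma leftOrthogonal_of_generatedBy {X Y : DPerf A} {M : DerivedCategory (ModuleCat.{v} A)}
    (hX : (generatedBy Y).prop X) (hY : (shiftOrbit M).leftOrthogonal Y.obj) :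
    (shiftOrbit M).leftOrthogonal X.obj :=
  (generatedBy_le_iff (U := ofInverseImage (perfectComplexes A) (shiftOrbit M).leftOrthogonal)).2
    hY _ hX

/-- Two indecomposable projective modules that are not isomorphic generate thick subcategories
meeting in zero: every simple module is orthogonal to one of the two, so an object of the
intersection is orthogonal to all finite length modules, hence to itself. -/
lemma isZero_of_generatedBy_of_generatedBy {P Q : Type v}
    [AddCommGroup P] [Module A P] [IsNoetherian A P] [IsArtinian A P] [Module.Projective A P]
    [AddCommGroup Q] [Module A Q] [IsNoetherian A Q] [IsArtinian A Q] [Module.Projective A Q]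
    (hP : IsIndecomposableModule A P) (hQ : IsIndecomposableModule A Q)
    (hPQ : IsEmpty (P ≃ₗ[A] Q)) (X : DPerf A)
    (hXP : (generatedBy (perfectOfModule A P)).prop X)
    (hXQ : (generatedBy (perfectOfModule A Q)).prop X) : IsZero X := by
  have hPproj := (IsProjective.iff_projective P).1 ‹_›
  have hQproj := (IsProjective.iff_projective Q).1 ‹_›
  have hsimple : ∀ (S : Type v) [AddCommGroup S] [Module A S] [IsSimpleModule A S],
      (shiftOrbit ((singleFunctor (ModuleCat.{v} A) 0).obj
        (ModuleCat.of A S))).leftOrthogonal X.obj := by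
    intro S _ _ _
    have := IsSimpleModule.nontrivial A S
    by_cases h : ∃ a : P →ₗ[A] S, a ≠ 0
    · obtain ⟨a, ha⟩ := h
      refine leftOrthogonal_of_generatedBy hXQ (leftOrthogonal_singleFunctor_iff.2 fun b => ?_)
      by_contra hb
      have hb' : b.hom ≠ 0 := fun h => hb (ModuleCat.hom_ext h)
      exact (not_nonempty_iff.2 hPQ) (hP.nonempty_linearEquiv_of_surjective hQ
        (LinearMap.surjective_of_ne_zero ha) (LinearMap.surjective_of_ne_zero hb'))
    · push Not at h
      exact leftOrthogonal_of_generatedBy hXP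
        (leftOrthogonal_singleFunctor_iff.2 fun a => ModuleCat.hom_ext (h a.hom))
  have hXP' := leftOrthogonal_singleFunctor_of_isFiniteLength hsimple
    (isFiniteLength_iff_isNoetherian_isArtinian.2 ⟨‹IsNoetherian A P›, ‹IsArtinian A P›⟩)
  rw [leftOrthogonal_shiftOrbit_iff_rightOrthogonal] at hXP'
  have hXX : (shiftOrbit X.obj).rightOrthogonal X.obj :=
    (generatedBy_le_iff (X := perfectOfModule A P) (U := ofInverseImage (perfectComplexes A)
      (shiftOrbit X.obj).rightOrthogonal)).2 hXP' _ hXP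
  rw [IsZero.iff_id_eq_zero]
  apply (perfectComplexes A).ι.map_injective
  exact hXX _ (shiftOrbit_self _)

end Perfect

/-- The case of finitely generated modules in the universe of the ring, which are themselves perfect
complexes. -/
lemma linearMap_eq_zero_of_latticeIsDistributive {k : Type u} [Field k] [IsAlgClosed k]
    {A : Type v} [Ring A] [Algebra k A] [Module.Finite k A]
    [HasDerivedCategory.{w} (ModuleCat.{v} A)]
    (hA : LatticeIsDistributive (ThickSubcategory (DPerf A)))
    {P Q : Type v}
    [AddCommGroup P] [Module A P] [IsNoetherian A P] [IsArtinian A P] [Module.Projective A P]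
    [AddCommGroup Q] [Module A Q] [IsNoetherian A Q] [IsArtinian A Q] [Module.Projective A Q]
    (hP : IsIndecomposableModule A P) (hQ : IsIndecomposableModule A Q)
    (hPQ : IsEmpty (P ≃ₗ[A] Q)) (f₀ : P →ₗ[A] Q) : f₀ = 0 := by
  by_contra hf₀
  let _ : Module k P := Module.compHom P (algebraMap k A)
  let _ : Module k Q := Module.compHom Q (algebraMap k A)
  have : IsScalarTower k A P := .of_compHom k A P
  have : IsScalarTower k A Q := .of_compHom k A Q
  have : Module.Finite k P := Module.Finite.trans A P
  have : Module.Finite k Q := Module.Finite.trans A Q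
  obtain ⟨Z, _, _, f, hf, w, hw⟩ := hP.exists_bijective_comp (k := k) hQ f₀ hf₀
  have hPproj := (IsProjective.iff_projective P).1 ‹_›
  have hQproj := (IsProjective.iff_projective Q).1 ‹_›
  let F : perfectOfModule A P ⟶ perfectOfModule A Q :=
    ⟨(DerivedCategory.singleFunctor (ModuleCat.{v} A) 0).map (ModuleCat.ofHom f)⟩
  obtain ⟨C, a, b, hD⟩ := distinguished_cocone_triangle F
  have hPC := ThickSubcategory.prop_generatedBy_of_distrib hA hD
    (isZero_of_generatedBy_of_generatedBy hP hQ hPQ)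
  have hf' : Function.Bijective fun u : ModuleCat.of A Q ⟶ ModuleCat.of A Z =>
      ModuleCat.ofHom f ≫ u :=
    (ModuleCat.homEquiv (M := ModuleCat.of A P) (N := ModuleCat.of A Z)).symm.bijective.comp
      (hf.comp (ModuleCat.homEquiv (M := ModuleCat.of A Q) (N := ModuleCat.of A Z)).bijective)
  have hZC : (shiftOrbit ((DerivedCategory.singleFunctor (ModuleCat.{v} A) 0).obj
      (ModuleCat.of A Z))).leftOrthogonal C.obj :=
    leftOrthogonal_obj₃_of_bijective ((perfectComplexes A).ι.map_distinguished _ hD)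
      (DerivedCategory.bijective_singleFunctor_map_comp _ hf')
  have hZP := leftOrthogonal_of_generatedBy hPC hZC
  exact hw (congrArg ModuleCat.Hom.hom
    (DerivedCategory.leftOrthogonal_singleFunctor_iff.1 hZP (ModuleCat.ofHom w)))

theorem mainTheorem5 {k : Type u} [Field k] [IsAlgClosed k]
    {A : Type v} [Ring A] [Algebra k A] [Module.Finite k A]
    [HasDerivedCategory.{w} (ModuleCat.{v} A)]
    (hA : LatticeIsDistributive (ThickSubcategory (DPerf A)))
    {P : Type p} [AddCommGroup P] [Module A P] [Module.Projective A P]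
    {Q : Type q} [AddCommGroup Q] [Module A Q] [Module.Projective A Q]
    (hP : IsIndecomposableModule A P) (hQ : IsIndecomposableModule A Q)
    (hPQ : IsEmpty (P ≃ₗ[A] Q)) :
    ∀ f : P →ₗ[A] Q, f = 0 := by
  intro f
  -- `P` and `Q` are replaced by isomorphic finitely generated modules in the universe of `A`
  have : IsArtinianRing A := IsArtinianRing.of_finite k A
  obtain ⟨P', _, _, _, _, _, hP', ⟨eP⟩⟩ := hP.exists_linearEquiv_finite
  obtain ⟨Q', _, _, _, _, _, hQ', ⟨eQ⟩⟩ := hQ.exists_linearEquiv_finite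
  have h0 := linearMap_eq_zero_of_latticeIsDistributive (k := k) hA hP' hQ'
    ⟨fun e => hPQ.elim (eP.symm ≪≫ₗ e ≪≫ₗ eQ)⟩ (eQ.symm.toLinearMap ∘ₗ f ∘ₗ eP.toLinearMap)
  ext x
  simpa using LinearMap.congr_fun h0 (eP.symm x)
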